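/- Let $p$ be a prime and let $G$ be a finite Camina $p$-group of nilpotence class $3$; that is, $G$ is a finite $p$-group of nilpotence class $3$ such that for every $g \in G \setminus G'$ the conjugacy class of $g$ is the coset $gG'$, where $G' = [G,G]$ is the derived subgroup. Put $G_3 = [G',G]$ and $H = G/G_3$. \begin{enumerate} \item If $H$ has exactly one or exactly two abelian subgroups of order $|H:H'|$, then $C_G(G') > G'$ (that is, $C_G(G')$ properly contains $G'$). \item If $H$ has exactly $p^a+1$ abelian subgroups of order $|H:H'|$ for some positive integer $a$, then either $C_G(G') > G'$ or $|G_3| \le p^{2a}$. \end{enumerate} -/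

import Mathlib

/-- A group `G` is a Camina group if the conjugacy class of `g` is the coset `gG'`
for every `g ∈ G \ G'`. -/
def IsCaminaGroup (G : Type*) [Group G] : Prop :=
  ∀ g : G, g ∉ commutator G → conjugatesOf g = (fun x => g * x) '' (commutator G : Set G)

/-- The third term `G₃ = [G', G]` of the lower central series `G = G₁ ≥ G₂ = G' ≥ G₃ ≥ ⋯`. -/
abbrev gammaThree (G : Type*) [Group G] : Subgroup G :=
  ⁅commutator G, (⊤ : Subgroup G)⁆

/-- The number of abelian subgroups of `H` whose order is `|H : H'|`. -/
noncomputable def numAbelianSubgroups (H : Type*) [Group H] : ℕ :=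
  Nat.card {A : Subgroup H // IsMulCommutative A ∧ Nat.card A = (commutator H).index}

/-! Suppose `C_G(G') ≤ G'`. Put `V = G/G'`, `W = G'/G₃`, `Z = G₃`; these are vector spaces over
`ZMod p`, and commutators induce an alternating `β : V × V → W` and a bilinear `γ : W × V → Z`, tied
by the Jacobi identity. The Camina condition says `β x` is onto for `x ≠ 0`; the assumption says `γ`
has trivial right radical.

Each nonzero functional `f` on `Z` has a radical `r f = {v | f (γ w v) = 0 for all w}`. Jacobi makes
`r f` isotropic for `β` of dimension `dim V - dim W` (`isotropic_ker_flip_of_jacobi`), so it yields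
an abelian subgroup of `H` of order `|H : H'|`. The key inequality `2 dim W ≤ dim V` comes from
Chevalley–Warning applied to a Pfaffian.

The nonzero functionals are partitioned by `r f`, each class together with zero is a subgroup, and
there are at least two classes. With `k` classes, counting gives `|Z| ≤ (k - 1)²`, so `|G₃| ≤ (n -
1)²` for `n` abelian subgroups of the required order. For `n ≤ 2` this contradicts `|G₃| > 1`; for
`n = p^a + 1` it is the stated bound. -/

/-! ### Determinants of alternating matrices -/

open Matrix in
theorem Matrix.dotProduct_mulVec_self_of_alternating {ι R : Type*} [Fintype ι] [CommRing R]
    (A : Matrix ι ι R) (hdiag : ∀ i, A i i = 0) (hskew : ∀ i j, A i j + A j i = 0) (x : ι → R) :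
    x ⬝ᵥ A *ᵥ x = 0 := by
  classical
  have h : x ⬝ᵥ A *ᵥ x = ∑ q : ι × ι, x q.1 * (A q.1 q.2 * x q.2) := by
    simp only [dotProduct, mulVec, Finset.mul_sum, Fintype.sum_prod_type]
  rw [h]
  -- The terms at `(i, j)` and `(j, i)` cancel; the fixed points are diagonal terms, which vanish.
  -- Characteristic 2 is thereby covered.
  refine Finset.sum_involution (fun q _ => q.swap) ?_ ?_ ?_ ?_
  · rintro ⟨i, j⟩ -
    simp only [Prod.swap]
    linear_combination x i * x j * hskew i j
  · rintro ⟨i, j⟩ - hne heq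
    obtain rfl : j = i := congrArg Prod.fst heq
    simp [hdiag] at hne
  · simp
  · simp

open Matrix in
/-- The determinant of an alternating matrix over a field is a square. -/
theorem Matrix.isSquare_det_of_alternating {K : Type*} [Field K] {ι : Type*} [Fintype ι]
    [DecidableEq ι] (A : Matrix ι ι K) (hA : ∀ x : ι → K, x ⬝ᵥ A *ᵥ x = 0) :
    IsSquare A.det := by
  induction hn : Fintype.card ι using Nat.strong_induction_on generalizing ι with
  | _ n ih =>
  have hdiag : ∀ i, A i i = 0 := fun i => by simpa using hA (Pi.single i 1)
  have hskew : ∀ i j, A i j + A j i = 0 := fun i j => by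
    have := hA (Pi.single i 1 + Pi.single j 1)
    simpa [Matrix.mulVec_add, hdiag, add_comm] using this
  by_cases h0 : A = 0
  · subst h0
    cases isEmpty_or_nonempty ι
    · simp
    · simp [Matrix.det_zero]
  obtain ⟨i, j, hij⟩ : ∃ i j, A i j ≠ 0 := by
    by_contra! h
    exact h0 (by ext i j; simp [h])
  have hne : i ≠ j := by rintro rfl; exact hij (hdiag i)
  have hji : A j i = - A i j := by linear_combination hskew i j
  -- Split off the block on `{i, j}`, whose determinant is `(A i j)²`, and induct on its Schur
  -- complement.
  let s : Fin 2 → ι := ![i, j]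
  let P : ι → Prop := fun k => k ≠ i ∧ k ≠ j
  let f : Fin 2 ⊕ {k // P k} → ι := Sum.elim s Subtype.val
  have hf : Function.Bijective f := by
    constructor
    · rintro (a | ⟨a, ha⟩) (b | ⟨b, hb⟩) hab
      · fin_cases a <;> fin_cases b
        · rfl
        · exact absurd hab hne
        · exact absurd hab hne.symm
        · rfl
      · fin_cases a
        · exact absurd hab.symm hb.1
        · exact absurd hab.symm hb.2
      · fin_cases b
        · exact absurd hab ha.1
        · exact absurd hab ha.2
      · exact congrArg Sum.inr (Subtype.ext hab)
    · intro k
      by_cases hk : P k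
      · exact ⟨Sum.inr ⟨k, hk⟩, rfl⟩
      · rcases not_and_or.1 hk with h | h
        · exact ⟨Sum.inl 0, (not_not.1 h).symm⟩
        · exact ⟨Sum.inl 1, (not_not.1 h).symm⟩
  let e := Equiv.ofBijective f hf
  let J : Matrix (Fin 2) (Fin 2) K := A.submatrix s s
  let B : Matrix (Fin 2) {k // P k} K := A.submatrix s Subtype.val
  let C : Matrix {k // P k} (Fin 2) K := A.submatrix Subtype.val s
  let D : Matrix {k // P k} {k // P k} K := A.submatrix Subtype.val Subtype.val
  have hblocks : A.submatrix e e = fromBlocks J B C D := by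
    ext (a | a) (b | b) <;> rfl
  have hJdet : J.det = A i j * A i j := by
    have h : J.det = A i i * A j j - A i j * A j i := Matrix.det_fin_two J
    rw [h, hdiag, hji]
    ring
  have hJunit : IsUnit J.det := by rw [hJdet]; exact (mul_ne_zero hij hij).isUnit
  let _ := J.invertibleOfIsUnitDet hJunit
  have hdet : A.det = J.det * (D - C * ⅟J * B).det := by
    rw [← Matrix.det_fromBlocks₁₁, ← hblocks, Matrix.det_submatrix_equiv_self]
  have hB : B = -Cᵀ := by
    ext a b
    simp only [B, C, submatrix_apply, neg_apply, transpose_apply]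
    linear_combination hskew (s a) b
  have hJ : ∀ y : Fin 2 → K, y ⬝ᵥ J *ᵥ y = 0 :=
    dotProduct_mulVec_self_of_alternating J (fun _ => hdiag _) (fun _ _ => hskew _ _)
  have hD : ∀ y, y ⬝ᵥ D *ᵥ y = 0 :=
    dotProduct_mulVec_self_of_alternating D (fun _ => hdiag _) (fun _ _ => hskew _ _)
  rw [hdet, hJdet]
  refine (IsSquare.mul_self _).mul (ih (Fintype.card {k // P k}) ?_ _ ?_ rfl)
  · rw [← hn]
    exact Fintype.card_subtype_lt (x := i) (by simp [P])
  -- The Schur complement is again alternating: with `y = J⁻¹ Cᵀ x`, the correction term at `x` is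
  -- `±(y ⬝ᵥ J *ᵥ y) = 0`.
  · intro x
    rw [Matrix.sub_mulVec, dotProduct_sub, hD, hB, zero_sub, neg_eq_zero]
    have h1 : (C * ⅟J * -Cᵀ) *ᵥ x = -(C *ᵥ (⅟J *ᵥ (Cᵀ *ᵥ x))) := by
      simp [Matrix.mul_assoc, Matrix.mulVec_mulVec, Matrix.neg_mulVec]
    have h2 : Cᵀ *ᵥ x = J *ᵥ (⅟J *ᵥ (Cᵀ *ᵥ x)) := by simp [Matrix.mulVec_mulVec, ← Matrix.mul_assoc]
    rw [h1, dotProduct_neg, dotProduct_mulVec, ← mulVec_transpose, neg_eq_zero]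
    generalize ⅟J *ᵥ (Cᵀ *ᵥ x) = y at h2 ⊢
    rw [h2, dotProduct_comm, hJ]

theorem Matrix.totalDegree_det_le {σ K ι : Type*} [CommRing K] [Fintype ι]
    [DecidableEq ι] (M : Matrix ι ι (MvPolynomial σ K)) (hM : ∀ i j, (M i j).totalDegree ≤ 1) :
    M.det.totalDegree ≤ Fintype.card ι := by
  rw [Matrix.det_apply']
  refine (MvPolynomial.totalDegree_finsetSum _ _).trans (Finset.sup_le fun τ _ => ?_)
  refine (MvPolynomial.totalDegree_mul _ _).trans ?_
  have h1 : ((Equiv.Perm.sign τ : ℤ) : MvPolynomial σ K).totalDegree = 0 := by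
    rw [← map_intCast (MvPolynomial.C : K →+* MvPolynomial σ K), MvPolynomial.totalDegree_C]
  rw [h1, zero_add]
  refine (MvPolynomial.totalDegree_finsetProd _ _).trans ?_
  refine (Finset.sum_le_card_nsmul _ _ 1 fun i _ => hM _ _).trans ?_
  simp

/-- A square root in the fraction field is integral. This brings the Pfaffian back to the polynomial
ring. -/
theorem isSquare_of_isSquare_algebraMap {R K : Type*} [CommRing R] [IsDomain R]
    [IsIntegrallyClosed R] [Field K] [Algebra R K] [IsFractionRing R K] {a : R}
    (h : IsSquare (algebraMap R K a)) : ∃ f : R, f * f = a := by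
  obtain ⟨r, hr⟩ := h
  obtain ⟨f, hf⟩ := IsIntegrallyClosed.exists_algebraMap_eq_of_isIntegral_pow (R := R) (x := r) (n := 2)
    (by norm_num) (by rw [sq, ← hr]; exact isIntegral_algebraMap)
  refine ⟨f, IsFractionRing.injective R K ?_⟩
  rw [map_mul, hf, hr]

/-! ### Alternating maps whose nonzero partial maps are onto -/

open Module in
/-- If `β` is an alternating map all of whose nonzero partial maps are onto, over a finite field,
then the target has at most half the dimension of the source. -/
theorem two_mul_finrank_le_of_alternating {K V W : Type*} [Field K] [Finite K]
    [AddCommGroup V] [Module K V] [FiniteDimensional K V] [Nontrivial V]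
    [AddCommGroup W] [Module K W] [FiniteDimensional K W]
    (β : V →ₗ[K] V →ₗ[K] W) (halt : ∀ x, β x x = 0)
    (hsurj : ∀ x, x ≠ 0 → Function.Surjective (β x)) :
    2 * finrank K W ≤ finrank K V := by
  classical
  by_contra! hlt
  have := Fintype.ofFinite K
  obtain ⟨p, hchar⟩ := CharP.exists K
  have hp : p.Prime := (CharP.char_is_prime_or_zero K p).resolve_right
    (CharP.char_ne_zero_of_finite K p)
  let b := finBasis K V
  let c := finBasis K W
  -- The Gram matrix of `ψ ∘ β` for the generic functional `ψ` on `W`; the variables are the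
  -- coordinates of `ψ`.
  let M : Matrix (Fin (finrank K V)) (Fin (finrank K V)) (MvPolynomial (Fin (finrank K W)) K) :=
    fun i j => ∑ k, MvPolynomial.C (c.repr (β (b i) (b j)) k) * MvPolynomial.X k
  have hskew : ∀ x y, β x y + β y x = 0 := fun x y => by
    simpa [halt] using halt (x + y)
  have hMdiag : ∀ i, M i i = 0 := fun i => by simp [M, halt]
  have hMskew : ∀ i j, M i j + M j i = 0 := fun i j => by
    simp only [M, ← Finset.sum_add_distrib, ← add_mul, ← map_add]
    refine Finset.sum_eq_zero fun k _ => ?_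
    rw [← Finsupp.add_apply, ← map_add, hskew]
    simp
  let F := FractionRing (MvPolynomial (Fin (finrank K W)) K)
  obtain ⟨f, hf⟩ : ∃ f, f * f = M.det := by
    apply isSquare_of_isSquare_algebraMap (K := F)
    rw [RingHom.map_det]
    refine Matrix.isSquare_det_of_alternating _
      (Matrix.dotProduct_mulVec_self_of_alternating _ (fun i => ?_) (fun i j => ?_))
    · simp [hMdiag]
    · simp only [RingHom.mapMatrix_apply, Matrix.map_apply]
      rw [← map_add, hMskew, map_zero]
  have heval : ∀ (t : Fin (finrank K W) → K) i j,
      MvPolynomial.eval t (M i j) = ∑ k, c.repr (β (b i) (b j)) k * t k := fun t i j => by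
    simp [M]
  -- A singular specialization gives `v ≠ 0` with `ψ ∘ β v = 0`, and surjectivity of `β v` forces `ψ
  -- = 0`.
  have hfeval : ∀ t, MvPolynomial.eval t f = 0 ↔ t = 0 := by
    intro t
    have hdet : MvPolynomial.eval t f * MvPolynomial.eval t f
        = (M.map (MvPolynomial.eval t)).det := by
      rw [← map_mul, hf, RingHom.map_det]; rfl
    rw [← mul_self_eq_zero, hdet]
    constructor
    · intro h
      obtain ⟨x, hx0, hx⟩ := Matrix.exists_vecMul_eq_zero_iff.2 h
      let ψ : W →ₗ[K] K := ∑ k, t k • c.coord k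
      let v : V := ∑ i, x i • b i
      have hv : v ≠ 0 := by
        intro hv
        exact hx0 (funext (Fintype.linearIndependent_iff.1 b.linearIndependent x hv))
      have hψ : ψ ∘ₗ β v = 0 := by
        refine b.ext fun j => ?_
        have := congrFun hx j
        simp only [Matrix.vecMul, dotProduct, Matrix.map_apply, heval, Pi.zero_apply] at this
        rw [LinearMap.zero_apply, ← this]
        simp only [LinearMap.comp_apply, v, map_sum, map_smul, LinearMap.sum_apply,
          LinearMap.smul_apply, smul_eq_mul, ψ, Basis.coord_apply, mul_comm]
      have hψ0 : ψ = 0 := by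
        ext w
        obtain ⟨y, rfl⟩ := hsurj v hv w
        exact LinearMap.congr_fun hψ y
      funext k
      have := LinearMap.congr_fun hψ0 (c k)
      simpa [ψ, Finsupp.single_apply] using this
    · rintro rfl
      have : M.map (MvPolynomial.eval (0 : Fin (finrank K W) → K)) = 0 := by
        ext i j
        simp only [Matrix.map_apply, heval, Pi.zero_apply, mul_zero, Finset.sum_const_zero,
          Matrix.zero_apply]
      rw [this]
      have : Nonempty (Fin (finrank K V)) := ⟨⟨0, finrank_pos⟩⟩
      exact Matrix.det_zero
  have hdet0 : M.det ≠ 0 := by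
    have hW : 0 < finrank K W := by omega
    intro h
    have := (hfeval (fun _ => 1)).1 (by
      rw [mul_self_eq_zero.1 (hf.trans h), map_zero])
    exact one_ne_zero (congrFun this ⟨0, hW⟩)
  have hf0 : f ≠ 0 := by rintro rfl; exact hdet0 (by rw [← hf, zero_mul])
  -- `2 deg f ≤ dim V < 2 dim W`, so Chevalley–Warning applies, yet `f` has exactly one zero.
  have hdeg : f.totalDegree < Fintype.card (Fin (finrank K W)) := by
    have h1 : M.det.totalDegree ≤ Fintype.card (Fin (finrank K V)) := by
      refine Matrix.totalDegree_det_le M fun i j => ?_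
      refine (MvPolynomial.totalDegree_finsetSum _ _).trans (Finset.sup_le fun k _ => ?_)
      refine (MvPolynomial.totalDegree_mul _ _).trans ?_
      simp
    rw [← hf, MvPolynomial.totalDegree_mul_of_isDomain hf0 hf0] at h1
    simp only [Fintype.card_fin] at h1 ⊢
    omega
  have hdvd := char_dvd_card_solutions p hdeg
  have hone : Fintype.card {t // MvPolynomial.eval t f = 0} = 1 := by
    rw [Fintype.card_eq_one_iff]
    exact ⟨⟨0, (hfeval 0).2 rfl⟩, fun t => Subtype.ext ((hfeval t.1).1 t.2)⟩
  rw [hone] at hdvd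
  exact hp.one_lt.ne' (Nat.dvd_one.1 hdvd)

open Module in
/-- Let `β` be alternating with all nonzero partial maps onto, and let `μ ≠ 0` satisfy the Jacobi
identity with `β`. Then the right radical of `μ` is totally isotropic for `β`, and its dimension
is complementary to that of `W`. -/
theorem isotropic_ker_flip_of_jacobi {K V W : Type*} [Field K] [Finite K]
    [AddCommGroup V] [Module K V] [FiniteDimensional K V]
    [AddCommGroup W] [Module K W] [FiniteDimensional K W]
    (β : V →ₗ[K] V →ₗ[K] W) (halt : ∀ x, β x x = 0)
    (hsurj : ∀ x, x ≠ 0 → Function.Surjective (β x))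
    (μ : W →ₗ[K] V →ₗ[K] K) (hμ : μ ≠ 0)
    (hjac : ∀ x y z, μ (β x y) z + μ (β y z) x + μ (β z x) y = 0) :
    (∀ x ∈ LinearMap.ker μ.flip, ∀ y ∈ LinearMap.ker μ.flip, β x y = 0) ∧
      finrank K (LinearMap.ker μ.flip) + finrank K W = finrank K V := by
  obtain ⟨w₀, v₀, h₀⟩ : ∃ w v, μ w v ≠ 0 := by
    by_contra! h
    exact hμ (by ext w v; simp [h])
  have hv₀ : v₀ ≠ 0 := by rintro rfl; simp at h₀
  have : Nontrivial V := ⟨v₀, 0, hv₀⟩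
  have hW := two_mul_finrank_le_of_alternating β halt hsurj
  have hflip : ∀ w x, x ∈ LinearMap.ker μ.flip → μ w x = 0 := fun w x hx =>
    LinearMap.congr_fun (LinearMap.mem_ker.1 hx) w
  have hiso : ∀ x ∈ LinearMap.ker μ.flip, ∀ y ∈ LinearMap.ker μ.flip, μ (β x y) = 0 := by
    intro x hx y hy
    ext z
    have := hjac x y z
    rw [hflip _ x hx, hflip _ y hy] at this
    simpa using this
  -- the radical is isotropic for the symplectic form `μ (β x y) v₀`
  have hR : 2 * finrank K (LinearMap.ker μ.flip) ≤ finrank K V := by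
    let B : LinearMap.BilinForm K V := β.compr₂ (μ.flip v₀)
    have hB : ∀ x y, B x y = μ (β x y) v₀ := fun _ _ => rfl
    have hker : LinearMap.ker B = ⊥ := by
      rw [LinearMap.ker_eq_bot']
      intro x hx
      by_contra hx0
      obtain ⟨y, hy⟩ := hsurj x hx0 w₀
      exact h₀ (by rw [← hy, ← hB, hx, LinearMap.zero_apply])
    have hle : LinearMap.ker μ.flip ≤ B.orthogonal (LinearMap.ker μ.flip) := by
      intro x hx
      rw [LinearMap.BilinForm.mem_orthogonal_iff]
      intro y hy
      rw [hB, hiso y hy x hx, LinearMap.zero_apply]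
    have h1 := LinearMap.BilinForm.finrank_add_finrank_orthogonal' (B := B)
      (LinearMap.ker μ.flip)
    have h2 := Submodule.finrank_mono hle
    rw [hker, inf_bot_eq, finrank_bot] at h1
    omega
  have hrank : finrank K (LinearMap.range μ.flip) ≤ finrank K (LinearMap.range μ) := by
    rw [← LinearMap.finrank_range_dualMap_eq_finrank_range μ]
    refine Submodule.finrank_mono ?_
    rintro _ ⟨v, rfl⟩
    exact ⟨Dual.eval K V v, rfl⟩
  have h1 := LinearMap.finrank_range_add_finrank_ker μ
  have h2 := LinearMap.finrank_range_add_finrank_ker μ.flip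
  -- `rank μ ≥ dim V - dim (ker μ.flip) ≥ dim V / 2 ≥ dim W`, so `μ` is injective and all these are
  -- equalities of rank with `dim W`.
  have hL : LinearMap.ker μ = ⊥ := Submodule.finrank_eq_zero.1 (by omega)
  refine ⟨fun x hx y hy => ?_, by omega⟩
  have : β x y ∈ LinearMap.ker μ := hiso x hx y hy
  rwa [hL, Submodule.mem_bot] at this

/-! ### Counting partitions into subgroups -/

/-- If the nonzero elements of a finite abelian group are partitioned into at least two classes,
each of which becomes a subgroup on adjoining zero, then the order of the group is at most
`(k - 1) ^ 2`, where `k` is the number of classes. -/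
theorem card_le_of_partition_into_subgroups {Y S : Type*} [AddCommGroup Y] [Fintype Y] [Nontrivial Y]
    [DecidableEq Y] [DecidableEq S]
    (r : Y → S) (Λ : S → AddSubgroup Y) (hΛ : ∀ y ≠ 0, ∀ z ≠ 0, z ∈ Λ (r y) ↔ r z = r y)
    (hne : ∀ y ≠ 0, ∃ z ≠ 0, r z ≠ r y) :
    Fintype.card Y ≤ (((Finset.univ.erase (0 : Y)).image r).card - 1) ^ 2 := by
  classical
  set T := (Finset.univ.erase (0 : Y)).image r
  have hmemT : ∀ y, y ≠ 0 → r y ∈ T := fun y hy =>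
    Finset.mem_image_of_mem _ (Finset.mem_erase.2 ⟨hy, Finset.mem_univ _⟩)
  have hself : ∀ y, y ≠ 0 → y ∈ Λ (r y) := fun y hy => (hΛ y hy y hy).2 rfl
  have hclass : ∀ s ∈ T,
      ((Finset.univ.erase (0 : Y)).filter fun y => r y = s).card ≤ T.card - 2 := by
    intro s hs
    obtain ⟨y, hy, rfl⟩ := Finset.mem_image.1 hs
    have hy0 : y ≠ 0 := (Finset.mem_erase.1 hy).1
    obtain ⟨z, hz0, hz⟩ := hne y hy0
    have hzΛ : z ∉ Λ (r y) := fun h => hz ((hΛ y hy0 z hz0).1 h)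
    let N := insert 0 ((Finset.univ.erase (0 : Y)).filter fun x => r x = r y)
    have hN : ∀ x ∈ N, x ∈ Λ (r y) := by
      intro x hx
      rcases Finset.mem_insert.1 hx with rfl | hx
      · exact zero_mem _
      · rw [Finset.mem_filter, Finset.mem_erase] at hx
        exact (hΛ y hy0 x hx.1.1).2 hx.2
    have hout : ∀ x ∈ N, z + x ∉ Λ (r y) := fun x hx h =>
      hzΛ (by simpa using sub_mem h (hN x hx))
    have hout0 : ∀ x ∈ N, z + x ≠ 0 := fun x hx h => hout x hx (by rw [h]; exact zero_mem _)
    -- The coset `z + N` misses the class of `y` and meets every other class at most once: a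
    -- difference of two members in one class would lie in two distinct classes.
    have hle : N.card ≤ (T.erase (r y)).card := by
      refine Finset.card_le_card_of_injOn (fun x => r (z + x)) ?_ ?_
      · intro x hx
        refine Finset.mem_coe.2 (Finset.mem_erase.2 ⟨fun h => ?_, hmemT _ (hout0 x hx)⟩)
        exact hout x hx ((hΛ y hy0 _ (hout0 x hx)).2 h)
      · intro x hx x' hx' h
        by_contra hxx
        have h1 : z + x ∈ Λ (r (z + x)) := hself _ (hout0 x hx)
        have h2 : z + x' ∈ Λ (r (z + x)) :=
          (hΛ _ (hout0 x hx) _ (hout0 x' hx')).2 h.symm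
        have h3 : x - x' ∈ Λ (r (z + x)) := by simpa using sub_mem h1 h2
        have h4 : x - x' ∈ Λ (r y) := sub_mem (hN x hx) (hN x' hx')
        have h5 : x - x' ≠ 0 := sub_ne_zero.2 hxx
        have h6 := (hΛ _ (hout0 x hx) _ h5).1 h3
        have h7 := (hΛ y hy0 _ h5).1 h4
        exact hout x hx ((hΛ y hy0 _ (hout0 x hx)).2 (h6.symm.trans h7))
    rw [Finset.card_insert_of_notMem (by simp), Finset.card_erase_of_mem hs] at hle
    omega
  have hcard : (Finset.univ.erase (0 : Y)).card ≤ T.card * (T.card - 2) := by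
    rw [Finset.card_eq_sum_card_image r]
    exact Finset.sum_le_card_nsmul _ _ _ hclass
  rw [Finset.card_erase_of_mem (Finset.mem_univ _), Finset.card_univ] at hcard
  have hge : 2 ≤ T.card := by
    obtain ⟨y, hy⟩ := exists_ne (0 : Y)
    obtain ⟨z, hz0, hz⟩ := hne y hy
    exact Finset.one_lt_card.2 ⟨r z, hmemT z hz0, r y, hmemT y hy, hz⟩
  obtain ⟨k, hk⟩ := Nat.exists_eq_add_of_le hge
  rw [hk] at hcard ⊢
  have h2 : 2 + k - 2 = k := by omega
  have h1 : 2 + k - 1 = k + 1 := by omega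
  rw [h2] at hcard
  rw [h1]
  have h3 : (k + 1) ^ 2 = (2 + k) * k + 1 := by ring
  omega

/-! ### Bilinear maps satisfying the Jacobi identity -/

theorem exists_bilinear_of_surjective (p : ℕ) {X Y A B C : Type*} [Group X] [Group Y]
    [AddCommGroup A] [Module (ZMod p) A] [AddCommGroup B] [Module (ZMod p) B]
    [AddCommGroup C] [Module (ZMod p) C]
    (π : X →* Multiplicative A) (hπ : Function.Surjective π)
    (ρ : Y →* Multiplicative B) (hρ : Function.Surjective ρ) (F : X → Y → C)
    (hl : ∀ x x' y, F (x * x') y = F x y + F x' y)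
    (hr : ∀ x y y', F x (y * y') = F x y + F x y')
    (hl0 : ∀ x ∈ π.ker, ∀ y, F x y = 0) (hr0 : ∀ x, ∀ y ∈ ρ.ker, F x y = 0) :
    ∃ β : A →ₗ[ZMod p] B →ₗ[ZMod p] C, ∀ x y, β (π x).toAdd (ρ y).toAdd = F x y := by
  have hlc : ∀ x x' y, π x = π x' → F x y = F x' y := fun x x' y h => by
    have := hl (x * x'⁻¹) x' y
    rwa [inv_mul_cancel_right, hl0 (x * x'⁻¹) (by simp [MonoidHom.mem_ker, h]), zero_add] at this
  have hrc : ∀ x y y', ρ y = ρ y' → F x y = F x y' := fun x y y' h => by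
    have := hr x (y * y'⁻¹) y'
    rwa [inv_mul_cancel_right, hr0 x (y * y'⁻¹) (by simp [MonoidHom.mem_ker, h]), zero_add] at this
  let s : A → X := fun a => Function.surjInv hπ (Multiplicative.ofAdd a)
  let t : B → Y := fun b => Function.surjInv hρ (Multiplicative.ofAdd b)
  have hs : ∀ a, π (s a) = Multiplicative.ofAdd a := fun a => Function.surjInv_eq hπ _
  have ht : ∀ b, ρ (t b) = Multiplicative.ofAdd b := fun b => Function.surjInv_eq hρ _
  let f : A → B →ₗ[ZMod p] C := fun a => AddMonoidHom.toZModLinearMap p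
    (AddMonoidHom.mk' (fun b => F (s a) (t b)) fun b b' => by
      rw [← hr]
      exact hrc _ _ _ (by rw [map_mul, ht, ht, ht, ofAdd_add]))
  have hf : ∀ a b, f a b = F (s a) (t b) := fun _ _ => rfl
  let g : A →+ B →ₗ[ZMod p] C := AddMonoidHom.mk' f fun a a' => by
    ext b
    rw [LinearMap.add_apply, hf, hf, hf, ← hl]
    exact hlc _ _ _ (by rw [map_mul, hs, hs, hs, ofAdd_add])
  refine ⟨AddMonoidHom.toZModLinearMap p g, fun x y => ?_⟩
  change F (s _) (t _) = _
  rw [hlc (s (π x).toAdd) x _ (by rw [hs, ofAdd_toAdd]),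
    hrc _ (t (ρ y).toAdd) y (by rw [ht, ofAdd_toAdd])]

open Module in
/-- Consider `β : V × V → W` alternating with all nonzero partial maps onto, and `γ : W × V → Z`
satisfying the Jacobi identity with `β`, with image spanning `Z` and trivial right radical.
Then `|Z| ≤ (k - 1) ^ 2`, where `k` is the number of totally isotropic subspaces of `V` of dimension
complementary to that of `W`. -/
theorem card_le_of_jacobi {K V W Z : Type*} [Field K] [Finite K]
    [AddCommGroup V] [Module K V] [FiniteDimensional K V]
    [AddCommGroup W] [Module K W] [FiniteDimensional K W]
    [AddCommGroup Z] [Module K Z] [FiniteDimensional K Z] [Nontrivial Z]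
    (β : V →ₗ[K] V →ₗ[K] W) (halt : ∀ x, β x x = 0)
    (hsurj : ∀ x, x ≠ 0 → Function.Surjective (β x))
    (γ : W →ₗ[K] V →ₗ[K] Z)
    (hjac : ∀ x y z, γ (β x y) z + γ (β y z) x + γ (β z x) y = 0)
    (hspan : ∀ f : Dual K Z, (∀ w v, f (γ w v) = 0) → f = 0)
    (hrad : ∀ v, (∀ w, γ w v = 0) → v = 0) :
    Nat.card Z ≤ (Nat.card {R : Submodule K V // (∀ x ∈ R, ∀ y ∈ R, β x y = 0) ∧
      finrank K R + finrank K W = finrank K V} - 1) ^ 2 := by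
  classical
  let r : Dual K Z → Submodule K V := fun f => LinearMap.ker (γ.compr₂ f).flip
  have hr : ∀ f v, v ∈ r f ↔ ∀ w, f (γ w v) = 0 := fun f v => by
    rw [LinearMap.mem_ker, LinearMap.ext_iff]
    rfl
  have hiso : ∀ f ≠ 0, (∀ x ∈ r f, ∀ y ∈ r f, β x y = 0) ∧
      finrank K (r f) + finrank K W = finrank K V := by
    intro f hf
    refine isotropic_ker_flip_of_jacobi β halt hsurj (γ.compr₂ f) (fun h => hf ?_)
      fun x y z => ?_
    · exact hspan f fun w v => LinearMap.congr_fun (LinearMap.congr_fun h w) v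
    · simp only [LinearMap.compr₂_apply, ← map_add, hjac, map_zero]
  let Λ : Submodule K V → AddSubgroup (Dual K Z) := fun R =>
    { carrier := {f | ∀ w, ∀ v ∈ R, f (γ w v) = 0}
      add_mem' := fun {f g} hf hg w v hv => by simp [hf w v hv, hg w v hv]
      zero_mem' := fun _ _ _ => rfl
      neg_mem' := fun {f} hf w v hv => by simp [hf w v hv] }
  have hΛ : ∀ f ≠ 0, ∀ g ≠ 0, g ∈ Λ (r f) ↔ r g = r f := by
    intro f hf g hg
    constructor
    · intro h
      have hle : r f ≤ r g := fun v hv => (hr g v).2 fun w => h w v hv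
      refine (Submodule.eq_of_le_of_finrank_eq hle ?_).symm
      have h1 := (hiso f hf).2
      have h2 := (hiso g hg).2
      omega
    · intro h w v hv
      rw [← h] at hv
      exact (hr g v).1 hv w
  have : Finite V := Module.finite_of_finite K
  have : Finite (Dual K Z) := Module.finite_of_finite K
  have := Fintype.ofFinite (Dual K Z)
  -- A common radical would lie in the right radical of `γ`, hence be zero; then `dim W = dim V`,
  -- against `2 dim W ≤ dim V`.
  have hne : ∀ f ≠ 0, ∃ g ≠ 0, r g ≠ r f := by
    intro f hf
    by_contra! h
    have hbot : r f = ⊥ := by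
      rw [eq_bot_iff]
      intro v hv
      refine hrad v fun w => ?_
      rw [← forall_dual_apply_eq_zero_iff K]
      intro g
      by_cases hg : g = 0
      · simp [hg]
      · rw [← h g hg] at hv
        exact (hr g v).1 hv w
    have hV : Nontrivial V := by
      by_contra hV
      rw [not_nontrivial_iff_subsingleton] at hV
      exact hf (hspan f fun w v => by rw [Subsingleton.elim v 0, map_zero, map_zero])
    have h1 := (hiso f hf).2
    have h2 := two_mul_finrank_le_of_alternating β halt hsurj
    have h3 : 0 < finrank K V := finrank_pos
    rw [hbot, finrank_bot] at h1
    omega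
  have hmain := card_le_of_partition_into_subgroups r Λ hΛ hne
  have hcard : Nat.card Z = Fintype.card (Dual K Z) := by
    rw [← Nat.card_eq_fintype_card, natCard_eq_pow_finrank (K := K) (V := Z),
      natCard_eq_pow_finrank (K := K) (V := Dual K Z), Subspace.dual_finrank_eq]
  rw [hcard]
  refine hmain.trans (Nat.pow_le_pow_left (Nat.sub_le_sub_right ?_ 1) 2)
  rw [← Fintype.card_coe, ← Nat.card_eq_fintype_card]
  refine Nat.card_le_card_of_injective (fun s => ⟨s.1, ?_⟩)
    fun s s' h => Subtype.ext (Subtype.mk.inj h)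
  obtain ⟨f, hf, hfs⟩ := Finset.mem_image.1 s.2
  rw [← hfs]
  exact hiso f (Finset.mem_erase.1 hf).1

/-! ### Commutators modulo `G₃` -/

section CommutatorCalculus

open scoped commutatorElement

variable {G : Type*} [Group G]

/-- The commutator of two elements, as an element of the derived subgroup. -/
def commutatorElt (g h : G) : commutator G :=
  ⟨⁅g, h⁆, Subgroup.commutator_mem_commutator (Subgroup.mem_top g) (Subgroup.mem_top h)⟩

/-- The commutator of an element of `G'` and an element of `G`, as an element of `G₃`. -/
def commutatorEltThree (c : commutator G) (g : G) : gammaThree G :=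
  ⟨⁅(c : G), g⁆, Subgroup.commutator_mem_commutator c.2 (Subgroup.mem_top g)⟩

theorem gammaThree_le_commutator : gammaThree G ≤ commutator G :=
  Subgroup.commutator_le_left _ _

theorem commutatorElement_mem_gammaThree_left {g : G} (hg : g ∈ commutator G) (h : G) :
    ⁅g, h⁆ ∈ gammaThree G :=
  Subgroup.commutator_mem_commutator hg (Subgroup.mem_top h)

theorem commutatorElement_mem_gammaThree_right (g : G) {h : G} (hh : h ∈ commutator G) :
    ⁅g, h⁆ ∈ gammaThree G := by
  rw [← commutatorElement_inv]
  exact inv_mem (commutatorElement_mem_gammaThree_left hh g)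

section Hom

theorem map_commutatorElt_symm {A : Type*} [Group A] (ρ : commutator G →* A) (a b : G) :
    ρ (commutatorElt a b) = (ρ (commutatorElt b a))⁻¹ := by
  rw [← map_inv]
  exact congrArg ρ (Subtype.ext (commutatorElement_inv b a).symm)

variable {A : Type*} [CommGroup A]
theorem map_eq_of_conj (ρ : commutator G →* A)
    (hρ : (gammaThree G).subgroupOf (commutator G) ≤ ρ.ker) {c d : commutator G} (g : G)
    (h : (d : G) = g * c * g⁻¹) : ρ d = ρ c := by
  have hd : d = commutatorElt g (c : G) * c := by
    ext
    simp [commutatorElt, commutatorElement_def, h]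
  have hk : commutatorElt g (c : G) ∈ ρ.ker :=
    hρ (Subgroup.mem_subgroupOf.2 (commutatorElement_mem_gammaThree_right g c.2))
  rw [hd, map_mul, MonoidHom.mem_ker.1 hk, one_mul]

theorem map_commutatorElt_mul_left (ρ : commutator G →* A)
    (hρ : (gammaThree G).subgroupOf (commutator G) ≤ ρ.ker) (a b c : G) :
    ρ (commutatorElt (a * b) c) = ρ (commutatorElt a c) * ρ (commutatorElt b c) := by
  let d : commutator G := ⟨a * ⁅b, c⁆ * a⁻¹,
    (inferInstance : (commutator G).Normal).conj_mem _ (commutatorElt b c).2 a⟩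
  have h : commutatorElt (a * b) c = d * commutatorElt a c :=
    Subtype.ext (commutatorElement_mul_left_eq_conj_mul a b c)
  rw [h, map_mul, map_eq_of_conj ρ hρ (c := commutatorElt b c) a rfl, mul_comm]

theorem map_commutatorElt_mul_right (ρ : commutator G →* A)
    (hρ : (gammaThree G).subgroupOf (commutator G) ≤ ρ.ker) (a b c : G) :
    ρ (commutatorElt a (b * c)) = ρ (commutatorElt a b) * ρ (commutatorElt a c) := by
  rw [map_commutatorElt_symm ρ, map_commutatorElt_mul_left ρ hρ, mul_inv,
    ← map_commutatorElt_symm ρ, ← map_commutatorElt_symm ρ]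

theorem map_commutatorElt_pow (ρ : commutator G →* A)
    (hρ : (gammaThree G).subgroupOf (commutator G) ≤ ρ.ker) (a b : G) (n : ℕ) :
    ρ (commutatorElt (a ^ n) b) = ρ (commutatorElt a b) ^ n := by
  induction n with
  | zero =>
    have : commutatorElt (a ^ 0) b = 1 := by ext; simp [commutatorElt]
    rw [this, map_one, pow_zero]
  | succ n ih => rw [pow_succ, map_commutatorElt_mul_left ρ hρ, ih, pow_succ]

end Hom

/-- The three subgroups lemma for `G, G, G'`. -/
theorem commutator_commute_of_gammaThree_le_center (h : gammaThree G ≤ Subgroup.center G)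
    {c d : G} (hc : c ∈ commutator G) (hd : d ∈ commutator G) : ⁅c, d⁆ = 1 := by
  have h4 : ⁅gammaThree G, (⊤ : Subgroup G)⁆ = ⊥ := by
    rw [Subgroup.commutator_eq_bot_iff_le_centralizer]
    intro x hx
    rw [Subgroup.coe_top, Subgroup.centralizer_univ]
    exact h hx
  have h5 : ⁅⁅(⊤ : Subgroup G), commutator G⁆, (⊤ : Subgroup G)⁆ = ⊥ := by
    rw [Subgroup.commutator_comm ⊤ (commutator G)]
    exact h4
  have h6 : ⁅commutator G, commutator G⁆ = ⊥ :=
    Subgroup.commutator_commutator_eq_bot_of_rotate h5 h4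
  rw [← Subgroup.mem_bot, ← h6]
  exact Subgroup.commutator_mem_commutator hc hd

theorem commutatorElement_mul_left_of_central {a b g : G} (h : ⁅b, g⁆ ∈ Subgroup.center G) :
    ⁅a * b, g⁆ = ⁅a, g⁆ * ⁅b, g⁆ := by
  rw [commutatorElement_mul_left_eq_conj_mul, Subgroup.mem_center_iff.1 h a,
    mul_assoc ⁅b, g⁆, mul_inv_cancel, mul_one]
  exact (Subgroup.mem_center_iff.1 h _).symm

theorem commutatorElement_mul_right_of_central {a g h : G} (hc : ⁅a, h⁆ ∈ Subgroup.center G) :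
    ⁅a, g * h⁆ = ⁅a, g⁆ * ⁅a, h⁆ := by
  rw [commutatorElement_mul_right_eq_mul_conj, mul_assoc ⁅a, g⁆,
    Subgroup.mem_center_iff.1 hc g, mul_assoc, mul_assoc, mul_inv_cancel, mul_one]

theorem exists_commutatorElement_eq (hC : IsCaminaGroup G) {g : G} (hg : g ∉ commutator G)
    {c : G} (hc : c ∈ commutator G) : ∃ x, ⁅g, x⁆ = c := by
  -- `⁅g, x⁆` is `g` times a conjugate of `g⁻¹`, so the Camina condition is needed at `g⁻¹`.
  have hg' : g⁻¹ ∉ commutator G := fun h => hg (inv_mem_iff.1 h)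
  have hmem : g⁻¹ * c ∈ conjugatesOf g⁻¹ := by
    rw [hC _ hg']
    exact ⟨c, hc, rfl⟩
  obtain ⟨x, hx⟩ := isConj_iff.1 (hmem)
  refine ⟨x, ?_⟩
  rw [commutatorElement_def, mul_assoc, mul_assoc, ← mul_assoc x, hx, mul_inv_cancel_left]

end CommutatorCalculus

/-! ### Exponent `p` of the factors `G/G'`, `G'/G₃` and `G₃` -/

section Camina

open scoped commutatorElement

variable {G : Type*} [Group G]

theorem exists_notMem_commutator (hcen : gammaThree G ≤ Subgroup.center G)
    (hbot : gammaThree G ≠ ⊥) : ∃ g : G, g ∉ commutator G := by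
  by_contra! h
  refine hbot ((Subgroup.commutator_eq_bot_iff_le_centralizer).2 fun c hc => ?_)
  rw [Subgroup.mem_centralizer_iff_commutator_eq_one]
  exact fun g _ => commutator_commute_of_gammaThree_le_center hcen (h g) hc

theorem commutator_quotient_mul_comm
    (c d : commutator G ⧸ (gammaThree G).subgroupOf (commutator G)) :
    c * d = d * c := by
  induction c using QuotientGroup.induction_on with | _ c
  induction d using QuotientGroup.induction_on with | _ d
  rw [← QuotientGroup.mk_mul, ← QuotientGroup.mk_mul, QuotientGroup.eq, Subgroup.mem_subgroupOf]
  have h : ((((c * d)⁻¹ * (d * c) : commutator G)) : G) = ⁅((d : G))⁻¹, ((c : G))⁻¹⁆ := by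
    simp [commutatorElement_def, mul_assoc]
  rw [h]
  exact commutatorElement_mem_gammaThree_left (inv_mem d.2) _

/-- The quotient `G' / G₃` is abelian. -/
@[reducible]
def commutatorQuotientCommGroup (G : Type*) [Group G] :
    CommGroup (commutator G ⧸ (gammaThree G).subgroupOf (commutator G)) :=
  { (inferInstance : Group (commutator G ⧸ (gammaThree G).subgroupOf (commutator G))) with
    mul_comm := commutator_quotient_mul_comm }

/-- If `g ^ p ∉ G'`, every element of `G'` is `⁅g ^ p, x⁆ ≡ ⁅g, x⁆ ^ p` modulo `G₃`, so the `p`-th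
power map is bijective on the `p`-group `G'/G₃`. Then `G' = G₃` is central and `G₃ = 1`. -/
theorem pow_mem_commutator [Finite G] {p : ℕ} [Fact p.Prime]
    (hC : IsCaminaGroup G) (hpG : IsPGroup p G) (hcen : gammaThree G ≤ Subgroup.center G)
    (hbot : gammaThree G ≠ ⊥) (g : G) : g ^ p ∈ commutator G := by
  by_contra hg
  let _ := commutatorQuotientCommGroup G
  let Q := commutator G ⧸ (gammaThree G).subgroupOf (commutator G)
  let ρ : commutator G →* Q := QuotientGroup.mk' _
  have hρ : (gammaThree G).subgroupOf (commutator G) ≤ ρ.ker := (QuotientGroup.ker_mk' _).ge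
  have hsurj : Function.Surjective (fun q : Q => q ^ p) := by
    intro q
    obtain ⟨c, rfl⟩ := QuotientGroup.mk'_surjective _ q
    obtain ⟨x, hx⟩ := exists_commutatorElement_eq hC hg c.2
    refine ⟨ρ (commutatorElt g x), ?_⟩
    change _ ^ p = _
    rw [← map_commutatorElt_pow ρ hρ]
    exact congrArg ρ (Subtype.ext hx)
  have hinj : Function.Injective (fun q : Q => q ^ p) := Finite.injective_iff_surjective.2 hsurj
  have hQ : IsPGroup p Q := (hpG.to_subgroup _).to_quotient _
  have hsub : Subsingleton Q := by
    by_contra hns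
    rw [not_subsingleton_iff_nontrivial] at hns
    obtain ⟨n, hn, hcard⟩ := hQ.nontrivial_iff_card.1 hns
    obtain ⟨q, hq⟩ := exists_prime_orderOf_dvd_card' (G := Q) p
      (hcard ▸ dvd_pow_self p hn.ne')
    have h1 : q = 1 := hinj (by
      change q ^ p = 1 ^ p
      rw [one_pow, ← hq, pow_orderOf_eq_one])
    rw [h1, orderOf_one] at hq
    exact (Fact.out : p.Prime).one_lt.ne hq
  have hle : commutator G ≤ gammaThree G :=
    Subgroup.subgroupOf_eq_top.1 (QuotientGroup.subgroup_eq_top_of_subsingleton _ hsub)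
  refine hbot ((Subgroup.commutator_eq_bot_iff_le_centralizer).2 fun c hc => ?_)
  rw [Subgroup.coe_top, Subgroup.centralizer_univ]
  exact hcen (hle hc)

/-- Write `c = ⁅g, x⁆` with `g ∉ G'`; then `c ^ p ≡ ⁅g ^ p, x⁆` modulo `G₃`, and `g ^ p ∈ G'`. -/
theorem pow_mem_gammaThree [Finite G] {p : ℕ} [Fact p.Prime]
    (hC : IsCaminaGroup G) (hpG : IsPGroup p G) (hcen : gammaThree G ≤ Subgroup.center G)
    (hbot : gammaThree G ≠ ⊥) {c : G} (hc : c ∈ commutator G) : c ^ p ∈ gammaThree G := by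
  let _ := commutatorQuotientCommGroup G
  let ρ : commutator G →* commutator G ⧸ (gammaThree G).subgroupOf (commutator G) :=
    QuotientGroup.mk' _
  have hρ : ρ.ker = (gammaThree G).subgroupOf (commutator G) := QuotientGroup.ker_mk' _
  obtain ⟨g, hg⟩ := exists_notMem_commutator hcen hbot
  obtain ⟨x, hx⟩ := exists_commutatorElement_eq hC hg hc
  have h1 : commutatorElt (g ^ p) x ∈ ρ.ker := by
    rw [hρ]
    exact Subgroup.mem_subgroupOf.2
      (commutatorElement_mem_gammaThree_left (pow_mem_commutator hC hpG hcen hbot g) x)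
  rw [MonoidHom.mem_ker, map_commutatorElt_pow ρ hρ.ge, ← map_pow, ← MonoidHom.mem_ker, hρ,
    Subgroup.mem_subgroupOf] at h1
  rw [← hx]
  exact h1

theorem pow_eq_one_of_mem_gammaThree [Finite G] {p : ℕ} [Fact p.Prime]
    (hC : IsCaminaGroup G) (hpG : IsPGroup p G) (hcen : gammaThree G ≤ Subgroup.center G)
    (hbot : gammaThree G ≠ ⊥) {z : G} (hz : z ∈ gammaThree G) : z ^ p = 1 := by
  have key : ∀ (c g : G), c ∈ commutator G → ∀ n : ℕ, ⁅c ^ n, g⁆ = ⁅c, g⁆ ^ n := by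
    intro c g hc n
    induction n with
    | zero => simp
    | succ n ih =>
      rw [pow_succ, commutatorElement_mul_left_of_central
        (hcen (commutatorElement_mem_gammaThree_left hc g)), ih, pow_succ]
  have hz' := hz
  rw [gammaThree, Subgroup.commutator_def] at hz
  induction hz using Subgroup.closure_induction with
  | mem x hx =>
    obtain ⟨c, hc, g, -, rfl⟩ := hx
    rw [← key c g hc, commutatorElement_eq_one_iff_mul_comm]
    exact (Subgroup.mem_center_iff.1 (hcen (pow_mem_gammaThree hC hpG hcen hbot hc)) g).symm
  | one => exact one_pow p
  | mul x y hx hy ihx ihy =>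
    rw [← Subgroup.commutator_def] at hx hy
    have hcomm : Commute x y := (Subgroup.mem_center_iff.1 (hcen hx) y).symm
    rw [hcomm.mul_pow, ihx hx, ihy hy, one_mul]
  | inv x hx ih =>
    rw [← Subgroup.commutator_def] at hx
    rw [inv_pow, ih hx, inv_one]

end Camina

/-! ### From groups to bilinear maps and back -/

section Main

open scoped commutatorElement
open Module

variable {G : Type*} [Group G]

/-- A bilinear presentation of the commutator structure gives a lower bound for the number of abelian
subgroups of `G / G₃` of order `|G : G'|`, in terms of isotropic subspaces. -/
theorem card_isotropic_le_numAbelianSubgroups [Finite G] {p : ℕ} [Fact p.Prime] {V W : Type*}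
    [AddCommGroup V] [Module (ZMod p) V] [Finite V]
    [AddCommGroup W] [Module (ZMod p) W] [Finite W]
    (π : G →* Multiplicative V) (hπ : Function.Surjective π) (hπk : π.ker = commutator G)
    (ρ : commutator G →* Multiplicative W) (hρ : Function.Surjective ρ)
    (hρk : ρ.ker = (gammaThree G).subgroupOf (commutator G))
    (β : V →ₗ[ZMod p] V →ₗ[ZMod p] W)
    (hβ : ∀ g h, β (π g).toAdd (π h).toAdd = (ρ (commutatorElt g h)).toAdd) :
    Nat.card {R : Submodule (ZMod p) V // (∀ x ∈ R, ∀ y ∈ R, β x y = 0) ∧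
      finrank (ZMod p) R + finrank (ZMod p) W = finrank (ZMod p) V} ≤
    numAbelianSubgroups (G ⧸ gammaThree G) := by
  let f : G →* G ⧸ gammaThree G := QuotientGroup.mk' (gammaThree G)
  have hf : Function.Surjective f := QuotientGroup.mk'_surjective _
  have hfk : f.ker = gammaThree G := QuotientGroup.ker_mk' _
  -- The image of `P R` in `G/G₃` is abelian by isotropy and has order `|R| |W| = |V|`.
  let P : Submodule (ZMod p) V → Subgroup G := fun R =>
    (AddSubgroup.toSubgroup R.toAddSubgroup).comap π
  have hP : ∀ R g, g ∈ P R ↔ (π g).toAdd ∈ R := fun _ _ => Iff.rfl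
  have hker : ∀ R, f.ker ≤ P R := fun R g hg => by
    rw [hfk] at hg
    have : π g = 1 := by
      rw [← MonoidHom.mem_ker, hπk]
      exact gammaThree_le_commutator hg
    rw [hP, this, toAdd_one]
    exact R.zero_mem
  have hidx : (commutator G).index = Nat.card V := by
    rw [← hπk, Subgroup.index_ker, MonoidHom.range_eq_top.2 hπ, Subgroup.card_top]
    rfl
  have hcomm : (commutator (G ⧸ gammaThree G)).index = Nat.card V := by
    have : commutator (G ⧸ gammaThree G) = (commutator G).map f := by
      refine ((Subgroup.map_commutator ⊤ ⊤ f).trans ?_).symm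
      rw [Subgroup.map_top_of_surjective f hf]
      rfl
    rw [this, Subgroup.index_map_eq _ hf (hfk.le.trans gammaThree_le_commutator), hidx]
  have hcardH : Nat.card (G ⧸ gammaThree G) = Nat.card W * Nat.card V := by
    have h1 : (gammaThree G).relIndex (commutator G) = Nat.card W := by
      rw [Subgroup.relIndex, ← hρk, Subgroup.index_ker, MonoidHom.range_eq_top.2 hρ,
        Subgroup.card_top]
      rfl
    rw [← Subgroup.index_eq_card, ← Subgroup.relIndex_mul_index gammaThree_le_commutator, h1, hidx]
  refine Nat.card_le_card_of_injective (fun R => ⟨(P R.1).map f, ?_, ?_⟩) ?_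
  · refine ⟨⟨?_⟩⟩
    rintro ⟨_, x, hx, rfl⟩ ⟨_, y, hy, rfl⟩
    refine Subtype.ext ?_
    change f x * f y = f y * f x
    rw [← commutatorElement_eq_one_iff_mul_comm, ← map_commutatorElement, ← MonoidHom.mem_ker, hfk]
    have h1 : commutatorElt x y ∈ ρ.ker := by
      rw [MonoidHom.mem_ker, ← toAdd_eq_zero, ← hβ]
      exact R.2.1 _ hx _ hy
    rw [hρk] at h1
    exact Subgroup.mem_subgroupOf.1 h1
  · have hR := R.2.2
    have hidxA : ((P R.1).map f).index = Nat.card W := by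
      rw [Subgroup.index_map_eq _ hf (hker R.1), Subgroup.index_comap_of_surjective _ hπ]
      have h1 : Nat.card R.1 * R.1.toAddSubgroup.index = Nat.card V :=
        AddSubgroup.card_mul_index R.1.toAddSubgroup
      have h2 : Nat.card R.1 * Nat.card W = Nat.card V := by
        rw [natCard_eq_pow_finrank (K := ZMod p) (V := R.1),
          natCard_eq_pow_finrank (K := ZMod p) (V := W),
          natCard_eq_pow_finrank (K := ZMod p) (V := V), ← pow_add, hR]
      exact Nat.eq_of_mul_eq_mul_left Nat.card_pos (h1.trans h2.symm)
    have h3 := Subgroup.card_mul_index ((P R.1).map f)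
    rw [hidxA, hcardH, mul_comm] at h3
    rw [hcomm]
    exact Nat.eq_of_mul_eq_mul_left Nat.card_pos h3
  · intro R R' h
    have h1 := Subgroup.map_injective_of_ker_le f (hker R.1) (hker R'.1) (Subtype.mk.inj h)
    have h2 := AddSubgroup.toSubgroup.injective (Subgroup.comap_injective hπ h1)
    exact Subtype.ext (Submodule.toAddSubgroup_injective h2)

/-- The Hall–Witt identity, whose outer conjugations are trivial since triple commutators are
central. -/
theorem jacobi_commutatorElement (hcen : gammaThree G ≤ Subgroup.center G) (a b c : G) :
    ⁅⁅a⁻¹, b⁆, c⁆ * ⁅⁅b⁻¹, c⁆, a⁆ * ⁅⁅c⁻¹, a⁆, b⁆ = 1 := by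
  have hz : ∀ x y z w : G, w * ⁅⁅x, y⁆, z⁆ = ⁅⁅x, y⁆, z⁆ * w := fun x y z w =>
    Subgroup.mem_center_iff.1
      (hcen (commutatorElement_mem_gammaThree_left (commutatorElt x y).2 z)) w
  have h := conj_commutatorElement_left_commutatorElement_mul a b c
  rw [hz _ _ _ a, mul_inv_cancel_right, mul_assoc _ c, hz _ _ _ c, ← mul_assoc,
    mul_inv_cancel_right, mul_assoc _ b, hz _ _ _ b, ← mul_assoc, mul_inv_cancel_right,
    mul_assoc, hz _ _ _ ⁅⁅c⁻¹, a⁆, b⁆, ← mul_assoc] at h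
  exact h

/-- If `G'` is its own centralizer, then `|G₃| ≤ (k - 1) ^ 2`, where `k` is the number of abelian
subgroups of `G / G₃` of order `|G : G'|`. -/
theorem card_gammaThree_le_of_presentation [Finite G] {p : ℕ} [Fact p.Prime] {V W Z : Type*}
    [AddCommGroup V] [Module (ZMod p) V] [Finite V]
    [AddCommGroup W] [Module (ZMod p) W] [Finite W]
    [AddCommGroup Z] [Module (ZMod p) Z] [Finite Z]
    (hC : IsCaminaGroup G) (hcen : gammaThree G ≤ Subgroup.center G) (hbot : gammaThree G ≠ ⊥)
    (hcentr : Subgroup.centralizer (commutator G : Set G) ≤ commutator G)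
    (π : G →* Multiplicative V) (hπ : Function.Surjective π) (hπk : π.ker = commutator G)
    (ρ : commutator G →* Multiplicative W) (hρ : Function.Surjective ρ)
    (hρk : ρ.ker = (gammaThree G).subgroupOf (commutator G))
    (ζ : gammaThree G ≃* Multiplicative Z) :
    Nat.card (gammaThree G) ≤ (numAbelianSubgroups (G ⧸ gammaThree G) - 1) ^ 2 := by
  have hcen' : ∀ (c : commutator G) (g : G), ⁅(c : G), g⁆ ∈ Subgroup.center G := fun c g =>
    hcen (commutatorElement_mem_gammaThree_left c.2 g)
  obtain ⟨β, hβ⟩ := exists_bilinear_of_surjective p π hπ π hπ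
    (fun g h => (ρ (commutatorElt g h)).toAdd)
    (fun a b c => by rw [map_commutatorElt_mul_left ρ hρk.ge, toAdd_mul])
    (fun a b c => by rw [map_commutatorElt_mul_right ρ hρk.ge, toAdd_mul])
    (fun g hg h => by
      rw [hπk] at hg
      have : commutatorElt g h ∈ ρ.ker := by
        rw [hρk]
        exact Subgroup.mem_subgroupOf.2 (commutatorElement_mem_gammaThree_left hg h)
      rw [MonoidHom.mem_ker.1 this, toAdd_one])
    (fun g h hh => by
      rw [hπk] at hh
      have : commutatorElt g h ∈ ρ.ker := by
        rw [hρk]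
        exact Subgroup.mem_subgroupOf.2 (commutatorElement_mem_gammaThree_right g hh)
      rw [MonoidHom.mem_ker.1 this, toAdd_one])
  obtain ⟨γ, hγ⟩ := exists_bilinear_of_surjective p ρ hρ π hπ
    (fun c g => (ζ (commutatorEltThree c g)).toAdd)
    (fun a b c => by
      rw [← toAdd_mul, ← map_mul]
      exact congrArg (fun t => (ζ t).toAdd)
        (Subtype.ext (commutatorElement_mul_left_of_central (hcen' b c))))
    (fun a b c => by
      rw [← toAdd_mul, ← map_mul]
      exact congrArg (fun t => (ζ t).toAdd)
        (Subtype.ext (commutatorElement_mul_right_of_central (hcen' a c))))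
    (fun c hc g => by
      rw [hρk, Subgroup.mem_subgroupOf] at hc
      have : commutatorEltThree c g = 1 := Subtype.ext
        (commutatorElement_eq_one_iff_mul_comm.2 (Subgroup.mem_center_iff.1 (hcen hc) g).symm)
      rw [this, map_one, toAdd_one])
    (fun c g hg => by
      rw [hπk] at hg
      have : commutatorEltThree c g = 1 := Subtype.ext
        (commutator_commute_of_gammaThree_le_center hcen c.2 hg)
      rw [this, map_one, toAdd_one])
  have hπ' : ∀ v : V, ∃ g, (π g).toAdd = v := fun v => hπ (Multiplicative.ofAdd v)
  have hρ' : ∀ w : W, ∃ c, (ρ c).toAdd = w := fun w => hρ (Multiplicative.ofAdd w)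
  have halt : ∀ x, β x x = 0 := by
    intro x
    obtain ⟨g, rfl⟩ := hπ' x
    have : commutatorElt g g = 1 := Subtype.ext (commutatorElement_self g)
    rw [hβ, this, map_one, toAdd_one]
  have hsurj : ∀ x, x ≠ 0 → Function.Surjective (β x) := by
    intro x hx w
    obtain ⟨g, rfl⟩ := hπ' x
    obtain ⟨c, rfl⟩ := hρ' w
    have hg : g ∉ commutator G := by
      rw [← hπk, MonoidHom.mem_ker]
      exact fun h => hx (by rw [h, toAdd_one])
    obtain ⟨y, hy⟩ := exists_commutatorElement_eq hC hg c.2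
    exact ⟨(π y).toAdd, by rw [hβ, show commutatorElt g y = c from Subtype.ext hy]⟩
  have hjac : ∀ x y z, γ (β x y) z + γ (β y z) x + γ (β z x) y = 0 := by
    intro x y z
    obtain ⟨a, rfl⟩ := hπ' x
    obtain ⟨b, rfl⟩ := hπ' y
    obtain ⟨c, rfl⟩ := hπ' z
    -- The inverses in Hall–Witt only change the sign of each term.
    have hneg : ∀ a b c : G, γ (β (π a).toAdd (π b).toAdd) (π c).toAdd =
        -(ζ (commutatorEltThree (commutatorElt a⁻¹ b) c)).toAdd := by
      intro a b c
      rw [← hγ, ← hβ, map_inv, toAdd_inv, map_neg, LinearMap.neg_apply, map_neg,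
        LinearMap.neg_apply, neg_neg]
    rw [hneg, hneg, hneg, ← neg_add, ← neg_add, neg_eq_zero, ← toAdd_mul, ← toAdd_mul, ← map_mul,
      ← map_mul]
    have : commutatorEltThree (commutatorElt a⁻¹ b) c * commutatorEltThree (commutatorElt b⁻¹ c) a *
        commutatorEltThree (commutatorElt c⁻¹ a) b = 1 :=
      Subtype.ext (jacobi_commutatorElement hcen a b c)
    rw [this, map_one, toAdd_one]
  have hspan : ∀ f : Dual (ZMod p) Z, (∀ w v, f (γ w v) = 0) → f = 0 := by
    intro f hf
    have key : ∀ x (hx : x ∈ gammaThree G), f (ζ ⟨x, hx⟩).toAdd = 0 := by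
      intro x hx
      refine Subgroup.closure_induction (p := fun x hx => f (ζ ⟨x, hx⟩).toAdd = 0)
        ?_ ?_ ?_ ?_ hx
      · rintro _ ⟨c, hc, g, -, rfl⟩
        rw [← hf (ρ ⟨c, hc⟩).toAdd (π g).toAdd, hγ]
        rfl
      · exact (congrArg (fun t => f t.toAdd) (map_one ζ)).trans (map_zero f)
      · intro x y hx hy h1 h2
        have h3 := congrArg (fun t => f t.toAdd) (map_mul ζ ⟨x, hx⟩ ⟨y, hy⟩)
        simp only [toAdd_mul, map_add, h1, h2, add_zero] at h3
        exact h3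
      · intro x hx h1
        have h3 := congrArg (fun t => f t.toAdd) (map_inv ζ ⟨x, hx⟩)
        simp only [toAdd_inv, map_neg, h1, neg_zero] at h3
        exact h3
    ext z
    obtain ⟨x, hx⟩ := ζ.surjective (Multiplicative.ofAdd z)
    have := key x.1 x.2
    rwa [Subtype.coe_eta, hx] at this
  have hrad : ∀ v, (∀ w, γ w v = 0) → v = 0 := by
    intro v hv
    obtain ⟨g, rfl⟩ := hπ' v
    have hg : g ∈ commutator G := by
      refine hcentr (Subgroup.mem_centralizer_iff_commutator_eq_one.2 fun c hc => ?_)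
      have h1 := hv (ρ ⟨c, hc⟩).toAdd
      rw [hγ] at h1
      have h2 : commutatorEltThree ⟨c, hc⟩ g = 1 := (map_eq_one_iff ζ ζ.injective).1 h1
      exact congrArg Subtype.val h2
    rw [← hπk, MonoidHom.mem_ker] at hg
    rw [hg, toAdd_one]
  have : Nontrivial (gammaThree G) := (Subgroup.nontrivial_iff_ne_bot _).2 hbot
  have : Nontrivial Z := ζ.symm.toEquiv.nontrivial
  have hcard : Nat.card (gammaThree G) = Nat.card Z := Nat.card_congr ζ.toEquiv
  rw [hcard]
  refine (card_le_of_jacobi β halt hsurj γ hjac hspan hrad).trans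
    (Nat.pow_le_pow_left (Nat.sub_le_sub_right ?_ 1) 2)
  exact card_isotropic_le_numAbelianSubgroups π hπ hπk ρ hρ hρk β hβ

theorem card_gammaThree_le_of_centralizer_le [Finite G] {p : ℕ} [Fact p.Prime]
    (hpG : IsPGroup p G)
    (hC : IsCaminaGroup G) (hcen : gammaThree G ≤ Subgroup.center G) (hbot : gammaThree G ≠ ⊥)
    (hcentr : Subgroup.centralizer (commutator G : Set G) ≤ commutator G) :
    Nat.card (gammaThree G) ≤ (numAbelianSubgroups (G ⧸ gammaThree G) - 1) ^ 2 := by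
  let _ := commutatorQuotientCommGroup G
  let _ : CommGroup (gammaThree G) :=
    { (inferInstance : Group (gammaThree G)) with
      mul_comm := fun x y => Subtype.ext (Subgroup.mem_center_iff.1 (hcen y.2) x) }
  let V := Additive (Abelianization G)
  let W := Additive (commutator G ⧸ (gammaThree G).subgroupOf (commutator G))
  let Z := Additive (gammaThree G)
  let _ : Module (ZMod p) V := AddCommGroup.zmodModule fun v => by
    obtain ⟨g, hg⟩ := QuotientGroup.mk_surjective (s := commutator G) v.toMul
    have h : Abelianization.of (g ^ p) = 1 := by
      rw [← MonoidHom.mem_ker, Abelianization.ker_of]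
      exact pow_mem_commutator hC hpG hcen hbot g
    rw [map_pow] at h
    change v.toMul ^ p = 1
    rw [← hg]
    exact h
  let _ : Module (ZMod p) W := AddCommGroup.zmodModule fun w => by
    obtain ⟨c, hc⟩ := QuotientGroup.mk_surjective w.toMul
    change w.toMul ^ p = 1
    rw [← hc, ← QuotientGroup.mk_pow, QuotientGroup.eq_one_iff, Subgroup.mem_subgroupOf]
    exact pow_mem_gammaThree hC hpG hcen hbot c.2
  let _ : Module (ZMod p) Z := AddCommGroup.zmodModule fun z =>
    Subtype.ext (pow_eq_one_of_mem_gammaThree hC hpG hcen hbot z.toMul.2)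
  have : Finite V := inferInstanceAs (Finite (G ⧸ commutator G))
  let π : G →* Multiplicative V :=
    { toFun := fun g => Multiplicative.ofAdd (Additive.ofMul (Abelianization.of g))
      map_one' := rfl
      map_mul' := fun _ _ => rfl }
  let ρ : commutator G →* Multiplicative W :=
    { toFun := fun c => Multiplicative.ofAdd (Additive.ofMul (QuotientGroup.mk c))
      map_one' := rfl
      map_mul' := fun _ _ => rfl }
  let ζ : gammaThree G ≃* Multiplicative Z :=
    { toFun := fun z => Multiplicative.ofAdd (Additive.ofMul z)
      invFun := fun z => z.toAdd.toMul
      left_inv := fun _ => rfl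
      right_inv := fun _ => rfl
      map_mul' := fun _ _ => rfl }
  refine card_gammaThree_le_of_presentation (p := p) hC hcen hbot hcentr π ?_ ?_ ρ ?_ ?_ ζ
  · exact QuotientGroup.mk_surjective
  · exact Abelianization.ker_of G
  · exact QuotientGroup.mk_surjective
  · exact QuotientGroup.ker_mk' _

end Main

theorem theorem1p2 (p : ℕ) (hp : p.Prime) (G : Type*) [Group G] [Finite G]
    (hpG : IsPGroup p G) (hCamina : IsCaminaGroup G) (hclass : Group.nilpotencyClass G = 3) :
    ((numAbelianSubgroups (G ⧸ gammaThree G) = 1 ∨ numAbelianSubgroups (G ⧸ gammaThree G) = 2) →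
      commutator G < Subgroup.centralizer (commutator G : Set G)) ∧
    (∀ a : ℕ, 0 < a → numAbelianSubgroups (G ⧸ gammaThree G) = p ^ a + 1 →
      commutator G < Subgroup.centralizer (commutator G : Set G) ∨
        Nat.card (gammaThree G) ≤ p ^ (2 * a)) := by
  have : Fact p.Prime := ⟨hp⟩
  have : Group.IsNilpotent G := hpG.isNilpotent
  -- The lower central series is indexed from `0`, so its term `3` is `[G₃, G]`.
  have h4 : ⁅gammaThree G, (⊤ : Subgroup G)⁆ = ⊥ :=
    (Subgroup.lowerCentralSeries_eq_bot_iff_nilpotencyClass_le (n := 3)).2 hclass.le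
  have hbot : gammaThree G ≠ ⊥ := fun h => by
    have := (Subgroup.lowerCentralSeries_eq_bot_iff_nilpotencyClass_le (G := G) (n := 2)).1 h
    omega
  have hcen : gammaThree G ≤ Subgroup.center G := by
    rw [Subgroup.commutator_eq_bot_iff_le_centralizer, Subgroup.coe_top,
      Subgroup.centralizer_univ] at h4
    exact h4
  have hle : commutator G ≤ Subgroup.centralizer (commutator G : Set G) := fun c hc =>
    Subgroup.mem_centralizer_iff_commutator_eq_one.2 fun d hd =>
      commutator_commute_of_gammaThree_le_center hcen hd hc
  have hmain : commutator G < Subgroup.centralizer (commutator G : Set G) ∨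
      Nat.card (gammaThree G) ≤ (numAbelianSubgroups (G ⧸ gammaThree G) - 1) ^ 2 := by
    by_cases h : Subgroup.centralizer (commutator G : Set G) ≤ commutator G
    · exact Or.inr (card_gammaThree_le_of_centralizer_le hpG hCamina hcen hbot h)
    · exact Or.inl (lt_of_le_not_ge hle h)
  have hcard : 1 < Nat.card (gammaThree G) := (Subgroup.one_lt_card_iff_ne_bot _).2 hbot
  constructor
  · intro h
    refine hmain.resolve_right fun hle' => ?_
    -- The bound is `0` or `1`, while `|G₃| > 1`.
    rcases h with h | h <;> rw [h] at hle' <;> omega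
  · intro a _ h
    refine hmain.imp_right fun hle' => ?_
    rwa [h, Nat.add_sub_cancel, ← pow_mul, mul_comm] at hle'
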